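/- A pointed linearly ordered set is a linearly ordered set $L$ with a distinguished element $1\in L$ (the unit); put $L_-=\{x\in L:x<1\}$ and $L_+=\{x\in L:x>1\}$. Let $FS_L=\bigcup_{n\ge1}L^n$ be the free semigroup of nonempty words over $L$ under concatenation, with $L=L^1\subset FS_L$. Let $\preceq$ be the smallest preorder on $FS_L$ that is compatible with the multiplication ($u\preceq v$ implies $uw\preceq vw$ and $wu\preceq wv$), contains the linear order of $L$, and contains the pairs $(x,x1),(x,1x),(x1,x),(1x,x),(x,xx),(xx,x)$ for all $x\in L$. Then $\rho=\{(u,v):u\preceq v,\ v\preceq u\}$ is a congruence on $FS_L$. The free Kuratowski monoid is $FK_L=FS_L/\rho$, with the quotient partial order and with the class of the word $1$ as unit, and $q_L:FS_L\to FK_L$ is the quotient homomorphism. A word $x_0\cdots x_n$ is alternating if each $\{x_i,x_{i+1}\}$ with $0\le i<n$ meets both $L_-$ and $L_+$. An alternating word $x_0\cdots x_n$ with $n\ge1$ is - a $V_\mp$-word if for some $m\in\{0,\dots,n-1\}$ the sequences $x_m,x_{m+2},x_{m+4},\dots$ and $x_m,x_{m-2},x_{m-4},\dots$ are strictly increasing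 in $L_-$, and $x_{m+1},x_{m+3},\dots$ and $x_{m+1},x_{m-1},x_{m-3},\dots$ are strictly decreasing in $L_+$; - a $V_\pm$-word if for some $m\in\{0,\dots,n-1\}$ the sequences $x_m,x_{m+2},\dots$ and $x_m,x_{m-2},\dots$ are strictly decreasing in $L_+$, and $x_{m+1},x_{m+3},\dots$ and $x_{m+1},x_{m-1},\dots$ are strictly increasing in $L_-$; - a $W_-$-word if for some $m\in\{1,\dots,n-1\}$ we have $x_{m-1}=x_{m+1}\in L_-$, the sequences $x_{m+1},x_{m+3},\dots$ and $x_{m-1},x_{m-3},\dots$ are strictly increasing in $L_-$, and $x_m,x_{m+2},\dots$ and $x_m,x_{m-2},\dots$ are strictly decreasing in $L_+$; - a $W_+$-word if for some $m\in\{1,\dots,n-1\}$ we have $x_{m-1}=x_{m+1}\in L_+$, the sequences $x_{m+1},x_{m+3},\dots$ and $x_{m-1},x_{m-3},\dots$ are strictly decreasing in $L_+$, and $x_m,x_{m+2},\dots$ and $x_m,x_{m-2},\dots$ are strictly increasing in $L_-$. Here every sequence runs over all its indices lying in $\{0,\dots,n\}$. The set $\mathcal K_L$ of Kuratowski words consists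 of the one-letter words and of all $V_\mp$-, $V_\pm$-, $W_-$- and $W_+$-words. **Theorem.** For every pointed linearly ordered set $L$ (finite or infinite), $q_L$ maps $\mathcal K_L$ bijectively onto $FK_L$. If moreover $L$ is finite, with $n=|L_-|$ and $p=|L_+|$, then $$|FK_L|=|\mathcal K_L|=K(n,p):=\sum_{i=0}^{n}\sum_{j=0}^{p}\binom{i+j}{i}\binom{i+j}{j}.$$ -/

import Mathlib

/-!
A pointed linearly ordered set is a type `L` with `[LinearOrder L] [One L]`; the unit is `1 : L`, and
no compatibility between `1` and the order is assumed. Its negative and positive parts are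
`Set.Iio (1 : L)` and `Set.Ioi (1 : L)`. The free semigroup of nonempty words is `FreeSemigroup L`.
-/

namespace Kuratowski

section Words

variable {L : Type*} [LinearOrder L] [One L]

/-- The `i`-th letter `x_i` of the word `w = x_0 ⋯ x_n`; the default value `1` is returned only
for `i > n`, and is never used below. -/
def letter (w : FreeSemigroup L) (i : ℕ) : L := (w.head :: w.tail).getD i 1

/-- The index `n` of the last letter of `w = x_0 ⋯ x_n` (so that `w` has length `n + 1`). -/
def lastIdx (w : FreeSemigroup L) : ℕ := w.tail.length

/-- Any two neighbouring letters form a doubleton meeting both `L_-` and `L_+`. -/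
def IsAlternating (w : FreeSemigroup L) : Prop :=
  ∀ i, i < lastIdx w →
    (({letter w i, letter w (i + 1)} : Set L) ∩ Set.Iio 1).Nonempty ∧
    (({letter w i, letter w (i + 1)} : Set L) ∩ Set.Ioi 1).Nonempty

/-- The sequence `(y i)_{i ∈ I}` is strictly increasing in `L_-`. -/
def IncNeg (I : Set ℕ) (y : ℕ → L) : Prop :=
  Set.MapsTo y I (Set.Iio 1) ∧ StrictMonoOn y I

/-- The sequence `(y i)_{i ∈ I}` is strictly decreasing in `L_+`. -/
def DecPos (I : Set ℕ) (y : ℕ → L) : Prop :=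
  Set.MapsTo y I (Set.Ioi 1) ∧ StrictAntiOn y I

/-- `V_∓`-words `x_0 ⋯ x_n`, `n ≥ 1`. -/
def IsVMinusPlus (w : FreeSemigroup L) : Prop :=
  IsAlternating w ∧ ∃ m, m < lastIdx w ∧
    IncNeg {i | m + 2 * i ≤ lastIdx w} (fun i => letter w (m + 2 * i)) ∧
    IncNeg {i | 2 * i ≤ m} (fun i => letter w (m - 2 * i)) ∧
    DecPos {i | m + 1 + 2 * i ≤ lastIdx w} (fun i => letter w (m + 1 + 2 * i)) ∧
    DecPos {i | 2 * i ≤ m + 1} (fun i => letter w (m + 1 - 2 * i))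

/-- `V_±`-words `x_0 ⋯ x_n`, `n ≥ 1`. -/
def IsVPlusMinus (w : FreeSemigroup L) : Prop :=
  IsAlternating w ∧ ∃ m, m < lastIdx w ∧
    DecPos {i | m + 2 * i ≤ lastIdx w} (fun i => letter w (m + 2 * i)) ∧
    DecPos {i | 2 * i ≤ m} (fun i => letter w (m - 2 * i)) ∧
    IncNeg {i | m + 1 + 2 * i ≤ lastIdx w} (fun i => letter w (m + 1 + 2 * i)) ∧
    IncNeg {i | 2 * i ≤ m + 1} (fun i => letter w (m + 1 - 2 * i))

/-- `W_-`-words `x_0 ⋯ x_n`, `n ≥ 1`. -/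
def IsWMinus (w : FreeSemigroup L) : Prop :=
  IsAlternating w ∧ ∃ m, 1 ≤ m ∧ m < lastIdx w ∧
    letter w (m - 1) = letter w (m + 1) ∧ letter w (m + 1) < 1 ∧
    IncNeg {i | m + 1 + 2 * i ≤ lastIdx w} (fun i => letter w (m + 1 + 2 * i)) ∧
    IncNeg {i | 2 * i ≤ m - 1} (fun i => letter w (m - 1 - 2 * i)) ∧
    DecPos {i | m + 2 * i ≤ lastIdx w} (fun i => letter w (m + 2 * i)) ∧
    DecPos {i | 2 * i ≤ m} (fun i => letter w (m - 2 * i))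

/-- `W_+`-words `x_0 ⋯ x_n`, `n ≥ 1`. -/
def IsWPlus (w : FreeSemigroup L) : Prop :=
  IsAlternating w ∧ ∃ m, 1 ≤ m ∧ m < lastIdx w ∧
    letter w (m - 1) = letter w (m + 1) ∧ 1 < letter w (m + 1) ∧
    DecPos {i | m + 1 + 2 * i ≤ lastIdx w} (fun i => letter w (m + 1 + 2 * i)) ∧
    DecPos {i | 2 * i ≤ m - 1} (fun i => letter w (m - 1 - 2 * i)) ∧
    IncNeg {i | m + 2 * i ≤ lastIdx w} (fun i => letter w (m + 2 * i)) ∧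
    IncNeg {i | 2 * i ≤ m} (fun i => letter w (m - 2 * i))

variable (L) in
/-- The set `𝒦_L = L¹ ∪ V_± ∪ V_∓ ∪ W_- ∪ W_+` of Kuratowski words. -/
def kuratowskiWords : Set (FreeSemigroup L) :=
  Set.range FreeSemigroup.of ∪ {w | IsVPlusMinus w} ∪ {w | IsVMinusPlus w} ∪
    {w | IsWMinus w} ∪ {w | IsWPlus w}

end Words

section Free

variable {L : Type*} [LinearOrder L] [One L]

open FreeSemigroup (of)

/-- The smallest compatible preorder on the free semigroup that contains the order of `L` and the
pairs `(x, x1)`, `(x, 1x)`, `(x1, x)`, `(1x, x)`, `(x, xx)`, `(xx, x)` for `x ∈ L`. -/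
inductive WordLE : FreeSemigroup L → FreeSemigroup L → Prop
  | of_le {x y : L} : x ≤ y → WordLE (of x) (of y)
  | le_mul_one (x : L) : WordLE (of x) (of x * of 1)
  | le_one_mul (x : L) : WordLE (of x) (of 1 * of x)
  | mul_one_le (x : L) : WordLE (of x * of 1) (of x)
  | one_mul_le (x : L) : WordLE (of 1 * of x) (of x)
  | le_sq (x : L) : WordLE (of x) (of x * of x)
  | sq_le (x : L) : WordLE (of x * of x) (of x)
  | refl (u : FreeSemigroup L) : WordLE u u
  | trans {u v w : FreeSemigroup L} : WordLE u v → WordLE v w → WordLE u w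
  | mul_right {u v : FreeSemigroup L} (w : FreeSemigroup L) : WordLE u v → WordLE (u * w) (v * w)
  | mul_left {u v : FreeSemigroup L} (w : FreeSemigroup L) : WordLE u v → WordLE (w * u) (w * v)

variable (L) in
/-- The congruence `{(u, v) : u ≼ v and v ≼ u}` on the free semigroup. -/
def wordCon : Con (FreeSemigroup L) where
  r u v := WordLE u v ∧ WordLE v u
  iseqv :=
    { refl := fun u => ⟨.refl u, .refl u⟩
      symm := fun h => ⟨h.2, h.1⟩
      trans := fun h k => ⟨h.1.trans k.1, k.2.trans h.2⟩ }
  mul' := fun {_ x y _} h k =>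
    ⟨(h.1.mul_right y).trans (k.1.mul_left x), (k.2.mul_left x).trans (h.2.mul_right y)⟩

variable (L) in
/-- The free Kuratowski monoid `FK_L`. -/
def FreeKuratowskiMonoid : Type _ := (wordCon L).Quotient

namespace FreeKuratowskiMonoid

instance : Semigroup (FreeKuratowskiMonoid L) := inferInstanceAs (Semigroup (wordCon L).Quotient)

variable (L) in
/-- The quotient homomorphism `q_L : FS_L → FK_L`. -/
def q : FreeSemigroup L →ₙ* FreeKuratowskiMonoid L where
  toFun w := (w : (wordCon L).Quotient)
  map_mul' _ _ := rfl

theorem q_surjective : Function.Surjective (q L) := Quotient.mk''_surjective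

theorem q_eq_q {u v : FreeSemigroup L} : q L u = q L v ↔ WordLE u v ∧ WordLE v u :=
  (wordCon L).eq

/-- The unit of `FK_L` is the class of the one-letter word `1`. -/
instance : Monoid (FreeKuratowskiMonoid L) where
  one := q L (of 1)
  one_mul a := by
    obtain ⟨w, rfl⟩ := q_surjective a
    change q L (of 1) * q L w = q L w
    induction w using FreeSemigroup.recOnMul with
    | ih1 x => rw [← map_mul]; exact q_eq_q.2 ⟨.one_mul_le x, .le_one_mul x⟩
    | ih2 x y hx _ => rw [map_mul, ← mul_assoc, hx]
  mul_one a := by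
    obtain ⟨w, rfl⟩ := q_surjective a
    change q L w * q L (of 1) = q L w
    induction w using FreeSemigroup.recOnMul with
    | ih1 x => rw [← map_mul]; exact q_eq_q.2 ⟨.mul_one_le x, .le_mul_one x⟩
    | ih2 x y _ hy => rw [map_mul, mul_assoc, hy]

/-- The quotient partial order on `FK_L`. -/
instance : PartialOrder (FreeKuratowskiMonoid L) where
  le := Quotient.lift₂ WordLE fun _ _ _ _ h k =>
    propext ⟨fun e => (h.2.trans e).trans k.1, fun e => (h.1.trans e).trans k.2⟩
  le_refl := by rintro ⟨u⟩; exact WordLE.refl u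
  le_trans := by rintro ⟨u⟩ ⟨v⟩ ⟨w⟩ h k; exact WordLE.trans h k
  le_antisymm := by rintro ⟨u⟩ ⟨v⟩ h k; exact Quotient.sound ⟨h, k⟩

end FreeKuratowskiMonoid

end Free

/-- `K(n, p) = ∑_{i=0}^n ∑_{j=0}^p C(i+j, i) C(i+j, j)`. -/
def kuratowskiNumber (n p : ℕ) : ℕ :=
  ∑ i ∈ Finset.range (n + 1), ∑ j ∈ Finset.range (p + 1), (i + j).choose i * (i + j).choose j

end Kuratowski

/-! Surjectivity. In `FK_L` every letter is idempotent, so a letter `z` lying weakly between `x` and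
the unit is absorbed: `zx = x = xz`. Hence two neighbours not on opposite sides of the unit merge
into one letter. Moreover `xyzt = xt` when `y`, `z` are on opposite sides, `x` absorbs `z` and `t`
absorbs `y`: replacing `y` or `z` by `1` gives `xt` in both cases, and the two replacements bound
`xyzt` from opposite sides (`mul_mul_mul_eq_of_weakInner`). A word that cannot be shortened in its
class therefore alternates and, once it stops moving away from the unit, must move towards it until
the end; this is a `V`- or `W`-word (`isVSeq_or_isWSeq`).

Injectivity. For monotone `f : L → SignType` with `f 1 = 0`, the first and the last nonzero sign of
`f` along a word are monotone for the preorder (`WordLE.firstSign_le`), so they are invariants of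
the class. A Kuratowski word of length at least two consists of a left half moving away from the
unit and a right half moving back, and both halves contain the extremal letters `a < 1 < b`. If `f`
vanishes on one half, it vanishes on `[a, b]`, so the first sign of the word is that of its left
half (`firstSign_glue`). First signs determine a list that moves away from the unit (`Asc.ext`);
hence both halves, and with them the word, are determined.

Counting. A word with at least two letters amounts to a choice of `a`, `b` and two independent
halves. Halves are counted by a recursion solved by the hockey-stick identity
(`finite_and_card_out`). If `a` and `b` are the `i`-th and `j`-th letters from the unit, there are
`C(i+j, i)` halves, whence the squares with `i, j ≥ 1`; the one-letter words supply the terms with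
`i = 0` or `j = 0`. -/

namespace Kuratowski

/-! ### Sign-free description of Kuratowski words -/

section Letters

variable {L : Type*} [LinearOrder L] [One L]

/-- The letters `x` and `y` lie on different sides of the unit. -/
def Opp (x y : L) : Prop := (x < 1 ∧ 1 < y) ∨ (y < 1 ∧ 1 < x)

/-- The letter `z` lies strictly between `x` and the unit. -/
def Inner (z x : L) : Prop := (x < z ∧ z < 1) ∨ (1 < z ∧ z < x)

theorem Opp.symm {x y : L} (h : Opp x y) : Opp y x := Or.symm h

theorem Opp.ne_one {x y : L} (h : Opp x y) : x ≠ 1 := by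
  rcases h with h | h
  · exact h.1.ne
  · exact h.2.ne'

theorem Opp.neg_iff {x y : L} (h : Opp x y) : x < 1 ↔ 1 < y := by
  rcases h with h | h
  · exact ⟨fun _ => h.2, fun _ => h.1⟩
  · exact ⟨fun k => absurd k h.2.not_gt, fun k => absurd k h.1.not_gt⟩

theorem Opp.pos_iff {x y : L} (h : Opp x y) : 1 < x ↔ y < 1 := h.symm.neg_iff.symm

theorem Inner.trans {x y z : L} (h : Inner x y) (k : Inner y z) : Inner x z := by
  rcases h with h | h <;> rcases k with k | k
  · exact .inl ⟨k.1.trans h.1, h.2⟩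
  · exact absurd (h.1.trans h.2) k.1.not_gt
  · exact absurd (h.1.trans h.2) k.2.not_gt
  · exact .inr ⟨h.1, h.2.trans k.2⟩

theorem Inner.irrefl {x : L} (h : Inner x x) : False := by
  rcases h with h | h
  · exact h.1.false
  · exact h.2.false

theorem Opp.of_inner {x y z : L} (h : Opp x y) (k : Inner z x) : Opp z y := by
  rcases h with h | h <;> rcases k with k | k
  · exact .inl ⟨k.2, h.2⟩
  · exact absurd (k.1.trans k.2) h.1.not_gt
  · exact absurd (k.1.trans k.2) h.2.not_gt
  · exact .inr ⟨h.1, k.1⟩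

theorem inter_nonempty_iff_opp {x y : L} :
    (({x, y} : Set L) ∩ Set.Iio 1).Nonempty ∧ (({x, y} : Set L) ∩ Set.Ioi 1).Nonempty ↔
      Opp x y := by
  constructor
  · rintro ⟨⟨a, ha, ha'⟩, ⟨b, hb, hb'⟩⟩
    simp only [Set.mem_insert_iff, Set.mem_singleton_iff, Set.mem_Iio, Set.mem_Ioi] at ha ha' hb hb'
    rcases ha with rfl | rfl <;> rcases hb with rfl | rfl
    · exact absurd ha' hb'.not_gt
    · exact .inl ⟨ha', hb'⟩
    · exact .inr ⟨ha', hb'⟩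
    · exact absurd ha' hb'.not_gt
  · rintro (h | h)
    · exact ⟨⟨x, by simp, h.1⟩, ⟨y, by simp, h.2⟩⟩
    · exact ⟨⟨y, by simp, h.1⟩, ⟨x, by simp, h.2⟩⟩

theorem isAlternating_iff {w : FreeSemigroup L} :
    IsAlternating w ↔ ∀ i, i < lastIdx w → Opp (letter w i) (letter w (i + 1)) :=
  forall₂_congr fun _ _ => inter_nonempty_iff_opp

/-- On an index set without gaps strict monotonicity is a condition on successive terms. `Inner`
expresses it in the same way on both sides of the unit, so that words of opposite signs can be
treated together. -/
theorem incNeg_iff {I : Set ℕ} (hI : I.OrdConnected) {y : ℕ → L} :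
    IncNeg I y ↔ (∀ i ∈ I, y i < 1) ∧ ∀ i, i ∈ I → i + 1 ∈ I → Inner (y (i + 1)) (y i) := by
  constructor
  · rintro ⟨h, k⟩
    exact ⟨h, fun i hi hj => .inl ⟨k hi hj (Nat.lt_succ_self i), h hj⟩⟩
  · rintro ⟨h, k⟩
    refine ⟨h, strictMonoOn_of_lt_succ hI fun i _ hi hj => ?_⟩
    rcases k i hi hj with m | m
    · exact m.1
    · exact absurd m.1 (h _ hj).not_gt

theorem decPos_iff {I : Set ℕ} (hI : I.OrdConnected) {y : ℕ → L} :
    DecPos I y ↔ (∀ i ∈ I, 1 < y i) ∧ ∀ i, i ∈ I → i + 1 ∈ I → Inner (y (i + 1)) (y i) := by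
  constructor
  · rintro ⟨h, k⟩
    exact ⟨h, fun i hi hj => .inr ⟨h hj, k hi hj (Nat.lt_succ_self i)⟩⟩
  · rintro ⟨h, k⟩
    refine ⟨h, strictAntiOn_of_succ_lt hI fun i _ hi hj => ?_⟩
    rcases k i hi hj with m | m
    · exact absurd m.2 (h _ hj).not_gt
    · exact m.2

theorem ordConnected_add_two_mul_le (m n : ℕ) : {i | m + 2 * i ≤ n}.OrdConnected :=
  ⟨fun i _ j hj k hk => by simp only [Set.mem_ofPred_eq, Set.mem_Icc] at *; omega⟩

theorem ordConnected_two_mul_le (n : ℕ) : {i | 2 * i ≤ n}.OrdConnected :=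
  ⟨fun i _ j hj k hk => by simp only [Set.mem_ofPred_eq, Set.mem_Icc] at *; omega⟩

/-- Neighbours among `c 0, …, c n` lie on different sides of the unit. -/
def AltSeq (c : ℕ → L) (n : ℕ) : Prop := ∀ i, i < n → Opp (c i) (c (i + 1))

/-- The letters `c 0, …, c k` move away from the unit, two steps at a time. -/
def Outward (c : ℕ → L) (k : ℕ) : Prop := ∀ i, i + 2 ≤ k → Inner (c i) (c (i + 2))

/-- The letters `c m, …, c n` move towards the unit, two steps at a time. -/
def Inward (c : ℕ → L) (m n : ℕ) : Prop := ∀ i, m ≤ i → i + 2 ≤ n → Inner (c (i + 2)) (c i)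

theorem AltSeq.neg_iff {c : ℕ → L} {n i : ℕ} (h : AltSeq c n) (hi : i + 2 ≤ n) :
    c i < 1 ↔ c (i + 2) < 1 :=
  (h i (by omega)).neg_iff.trans (h (i + 1) (by omega)).pos_iff

theorem AltSeq.pos_iff {c : ℕ → L} {n i : ℕ} (h : AltSeq c n) (hi : i + 2 ≤ n) :
    1 < c i ↔ 1 < c (i + 2) :=
  (h i (by omega)).pos_iff.trans (h (i + 1) (by omega)).neg_iff

theorem AltSeq.neg_add {c : ℕ → L} {n m : ℕ} (h : AltSeq c n) (hm : c m < 1) (i : ℕ)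
    (hi : m + 2 * i ≤ n) : c (m + 2 * i) < 1 := by
  induction i with
  | zero => exact hm
  | succ i ih => exact (h.neg_iff (i := m + 2 * i) (by omega)).1 (ih (by omega))

theorem AltSeq.pos_add {c : ℕ → L} {n m : ℕ} (h : AltSeq c n) (hm : 1 < c m) (i : ℕ)
    (hi : m + 2 * i ≤ n) : 1 < c (m + 2 * i) := by
  induction i with
  | zero => exact hm
  | succ i ih => exact (h.pos_iff (i := m + 2 * i) (by omega)).1 (ih (by omega))

theorem AltSeq.neg_sub {c : ℕ → L} {n m : ℕ} (h : AltSeq c n) (hn : m ≤ n) (hm : c m < 1) (i : ℕ)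
    (hi : 2 * i ≤ m) : c (m - 2 * i) < 1 := by
  rcases lt_trichotomy (c (m - 2 * i)) 1 with k | k | k
  · exact k
  · exfalso
    -- Alternation excludes the letter `1` only where there is a next letter, hence the separate
    -- case `i = 0`.
    rcases Nat.eq_zero_or_pos i with rfl | hi'
    · exact hm.ne k
    · exact (h (m - 2 * i) (by omega)).ne_one k
  · have := h.pos_add k i (by omega)
    rw [Nat.sub_add_cancel hi] at this
    exact absurd this hm.not_gt

theorem AltSeq.pos_sub {c : ℕ → L} {n m : ℕ} (h : AltSeq c n) (hn : m ≤ n) (hm : 1 < c m) (i : ℕ)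
    (hi : 2 * i ≤ m) : 1 < c (m - 2 * i) := by
  rcases lt_trichotomy (c (m - 2 * i)) 1 with k | k | k
  · have := h.neg_add k i (by omega)
    rw [Nat.sub_add_cancel hi] at this
    exact absurd this hm.not_gt
  · exfalso
    rcases Nat.eq_zero_or_pos i with rfl | hi'
    · exact hm.ne' k
    · exact (h (m - 2 * i) (by omega)).ne_one k
  · exact k

theorem inward_iff {c : ℕ → L} {m n : ℕ} :
    Inward c m n ↔
      (∀ i, i ∈ {i | m + 2 * i ≤ n} → i + 1 ∈ {i | m + 2 * i ≤ n} →
        Inner (c (m + 2 * (i + 1))) (c (m + 2 * i))) ∧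
      (∀ i, i ∈ {i | m + 1 + 2 * i ≤ n} → i + 1 ∈ {i | m + 1 + 2 * i ≤ n} →
        Inner (c (m + 1 + 2 * (i + 1))) (c (m + 1 + 2 * i))) := by
  constructor
  · exact fun h => ⟨fun i _ hi => h (m + 2 * i) (by omega) hi,
      fun i _ hi => h (m + 1 + 2 * i) (by omega) hi⟩
  · rintro ⟨h, k⟩ i hi hn
    obtain ⟨j, rfl⟩ := Nat.exists_eq_add_of_le hi
    obtain ⟨t, rfl | rfl⟩ := Nat.even_or_odd' j
    · exact h t (by simp only [Set.mem_ofPred_eq]; omega) (by simp only [Set.mem_ofPred_eq]; omega)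
    · have := k t (by simp only [Set.mem_ofPred_eq]; omega)
        (by simp only [Set.mem_ofPred_eq]; omega)
      rw [show m + 1 + 2 * t = m + (2 * t + 1) by omega,
        show m + 1 + 2 * (t + 1) = m + (2 * t + 1) + 2 by omega] at this
      exact this

theorem outward_succ_iff {c : ℕ → L} {m : ℕ} :
    Outward c (m + 1) ↔
      (∀ i, i ∈ {i | 2 * i ≤ m} → i + 1 ∈ {i | 2 * i ≤ m} →
        Inner (c (m - 2 * (i + 1))) (c (m - 2 * i))) ∧
      (∀ i, i ∈ {i | 2 * i ≤ m + 1} → i + 1 ∈ {i | 2 * i ≤ m + 1} →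
        Inner (c (m + 1 - 2 * (i + 1))) (c (m + 1 - 2 * i))) := by
  constructor
  · intro h
    constructor
    · intro i _ hi
      simp only [Set.mem_ofPred_eq] at hi
      have := h (m - 2 * (i + 1)) (by omega)
      rwa [show m - 2 * (i + 1) + 2 = m - 2 * i by omega] at this
    · intro i _ hi
      simp only [Set.mem_ofPred_eq] at hi
      have := h (m + 1 - 2 * (i + 1)) (by omega)
      rwa [show m + 1 - 2 * (i + 1) + 2 = m + 1 - 2 * i by omega] at this
  · rintro ⟨h, k⟩ i hi
    obtain ⟨j, hj⟩ := Nat.exists_eq_add_of_le hi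
    obtain ⟨t, rfl | rfl⟩ := Nat.even_or_odd' j
    · have := k t (by simp only [Set.mem_ofPred_eq]; omega)
        (by simp only [Set.mem_ofPred_eq]; omega)
      rwa [show m + 1 - 2 * (t + 1) = i by omega, show m + 1 - 2 * t = i + 2 by omega] at this
    · have := h t (by simp only [Set.mem_ofPred_eq]; omega)
        (by simp only [Set.mem_ofPred_eq]; omega)
      rwa [show m - 2 * (t + 1) = i by omega, show m - 2 * t = i + 2 by omega] at this

/-- `c 0, …, c n` is a `V`-sequence of either sign. -/
def IsVSeq (c : ℕ → L) (n : ℕ) : Prop :=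
  AltSeq c n ∧ ∃ m, m < n ∧ Outward c (m + 1) ∧ Inward c m n

/-- `c 0, …, c n` is a `W`-sequence of either sign. -/
def IsWSeq (c : ℕ → L) (n : ℕ) : Prop :=
  AltSeq c n ∧ ∃ m, m + 1 < n ∧ c m = c (m + 2) ∧ Outward c (m + 1) ∧ Inward c (m + 1) n

/-- Alternation propagates the signs of the letters at `m` and `m + 1` along both parities, so the
sign conditions are automatic and the sign at `m` decides between the two kinds of word. -/
theorem isVSeq_iff {w : FreeSemigroup L} :
    IsVSeq (letter w) (lastIdx w) ↔ IsVPlusMinus w ∨ IsVMinusPlus w := by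
  simp only [IsVPlusMinus, IsVMinusPlus, IsVSeq, isAlternating_iff, ← and_or_left, ← exists_or,
    incNeg_iff (ordConnected_add_two_mul_le _ _), incNeg_iff (ordConnected_two_mul_le _),
    decPos_iff (ordConnected_add_two_mul_le _ _), decPos_iff (ordConnected_two_mul_le _)]
  refine and_congr_right fun ha => exists_congr fun m => and_congr_right fun hm => ?_
  replace ha : AltSeq (letter w) (lastIdx w) := ha
  rw [inward_iff, outward_succ_iff]
  constructor
  · rintro ⟨⟨h₁, h₂⟩, h₃, h₄⟩
    rcases ha m hm with k | k
    · exact .inr ⟨⟨fun i hi => ha.neg_add k.1 i hi, h₃⟩,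
        ⟨fun i hi => ha.neg_sub hm.le k.1 i hi, h₁⟩,
        ⟨fun i hi => ha.pos_add k.2 i hi, h₄⟩, ⟨fun i hi => ha.pos_sub hm k.2 i hi, h₂⟩⟩
    · exact .inl ⟨⟨fun i hi => ha.pos_add k.2 i hi, h₃⟩,
        ⟨fun i hi => ha.pos_sub hm.le k.2 i hi, h₁⟩,
        ⟨fun i hi => ha.neg_add k.1 i hi, h₄⟩, ⟨fun i hi => ha.neg_sub hm k.1 i hi, h₂⟩⟩
  · rintro (⟨⟨-, h₁⟩, ⟨-, h₂⟩, ⟨-, h₃⟩, ⟨-, h₄⟩⟩ | ⟨⟨-, h₁⟩, ⟨-, h₂⟩, ⟨-, h₃⟩, ⟨-, h₄⟩⟩)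
    · exact ⟨⟨h₂, h₄⟩, h₁, h₃⟩
    · exact ⟨⟨h₂, h₄⟩, h₁, h₃⟩

theorem isWSeq_iff {w : FreeSemigroup L} :
    IsWSeq (letter w) (lastIdx w) ↔ IsWMinus w ∨ IsWPlus w := by
  simp only [IsWMinus, IsWPlus, IsWSeq, isAlternating_iff, ← and_or_left, ← exists_or,
    incNeg_iff (ordConnected_add_two_mul_le _ _), incNeg_iff (ordConnected_two_mul_le _),
    decPos_iff (ordConnected_add_two_mul_le _ _), decPos_iff (ordConnected_two_mul_le _)]
  refine and_congr_right fun ha => ?_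
  replace ha : AltSeq (letter w) (lastIdx w) := ha
  constructor
  · rintro ⟨m, hm, he, h, h'⟩
    obtain ⟨h₁, h₂⟩ := outward_succ_iff.1 h
    obtain ⟨h₃, h₄⟩ := inward_iff.1 h'
    -- In `IsWSeq` the index `m` marks the left one of the two equal letters; the centre of the word
    -- is at `m + 1`.
    refine ⟨m + 1, by omega, hm, he, ?_⟩
    simp only [Nat.add_sub_cancel]
    rcases ha m (by omega) with k | k
    · have k' := (ha.neg_iff hm).1 k.1
      exact .inl ⟨k', ⟨fun i hi => ha.neg_add k' i hi, h₄⟩,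
        ⟨fun i hi => ha.neg_sub (by omega) k.1 i hi, h₁⟩,
        ⟨fun i hi => ha.pos_add k.2 i hi, h₃⟩, ⟨fun i hi => ha.pos_sub hm.le k.2 i hi, h₂⟩⟩
    · have k' := (ha.pos_iff hm).1 k.2
      exact .inr ⟨k', ⟨fun i hi => ha.pos_add k' i hi, h₄⟩,
        ⟨fun i hi => ha.pos_sub (by omega) k.2 i hi, h₁⟩,
        ⟨fun i hi => ha.neg_add k.1 i hi, h₃⟩, ⟨fun i hi => ha.neg_sub hm.le k.1 i hi, h₂⟩⟩
  · rintro ⟨m, hm, hn, he, h⟩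
    obtain ⟨m, rfl⟩ := Nat.exists_eq_add_of_le' hm
    refine ⟨m, hn, he, ?_⟩
    rw [inward_iff, outward_succ_iff]
    rcases h with ⟨-, ⟨-, h₁⟩, ⟨-, h₂⟩, ⟨-, h₃⟩, ⟨-, h₄⟩⟩ | ⟨-, ⟨-, h₁⟩, ⟨-, h₂⟩, ⟨-, h₃⟩, ⟨-, h₄⟩⟩
    · exact ⟨⟨h₂, h₄⟩, h₃, h₁⟩
    · exact ⟨⟨h₂, h₄⟩, h₃, h₁⟩

theorem mem_kuratowskiWords {w : FreeSemigroup L} :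
    w ∈ kuratowskiWords L ↔ (∃ x, w = FreeSemigroup.of x) ∨
      IsVSeq (letter w) (lastIdx w) ∨ IsWSeq (letter w) (lastIdx w) := by
  rw [isVSeq_iff, isWSeq_iff]
  simp only [kuratowskiWords, Set.mem_union, Set.mem_range, Set.mem_ofPred_eq, or_assoc, eq_comm]

end Letters

/-! ### Words as lists of letters -/

section Lists

variable {L : Type*}

/-- The list of letters of a nonempty word. -/
def toList (w : FreeSemigroup L) : List L := w.head :: w.tail

theorem toList_mul (u v : FreeSemigroup L) : toList (u * v) = toList u ++ toList v := rfl

variable [One L]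

/-- The word with a given list of letters; the empty list gives the word `1`. -/
def ofList : List L → FreeSemigroup L
  | [] => FreeSemigroup.of 1
  | x :: l => ⟨x, l⟩

theorem ofList_toList (w : FreeSemigroup L) : ofList (toList w) = w := rfl

theorem toList_ofList {l : List L} (h : l ≠ []) : toList (ofList l) = l := by
  cases l with
  | nil => exact absurd rfl h
  | cons x l => rfl

theorem letter_eq (w : FreeSemigroup L) : letter w = fun i => (toList w).getD i 1 := rfl

theorem lastIdx_ofList (l : List L) : lastIdx (ofList l) = l.length - 1 := by
  cases l <;> rfl

theorem letter_ofList {l : List L} (h : l ≠ []) : letter (ofList l) = fun i => l.getD i 1 := by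
  rw [letter_eq, toList_ofList h]

theorem getD_reverse_append (l z : List L) (p q : L) (i : ℕ) (hi : i ≤ l.length + 1) :
    (l.reverse ++ q :: p :: z).getD i 1 = (p :: q :: l).getD (l.length + 1 - i) 1 := by
  rw [show l.reverse ++ q :: p :: z = (p :: q :: l).reverse ++ z by simp,
    List.getD_append _ _ _ _ (by simp; omega), List.getD_reverse _ (by simp; omega)]
  simp

theorem eq_take_append_two (l : List L) (i : ℕ) (h : i + 1 < l.length) :
    l = l.take i ++ ([l.getD i 1, l.getD (i + 1) 1] ++ l.drop (i + 2)) := by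
  conv_lhs => rw [← List.take_append_drop i l, List.drop_eq_getElem_cons (by omega : i < l.length),
    List.drop_eq_getElem_cons h]
  simp [List.getD_eq_getElem?_getD, h, (by omega : i < l.length)]

theorem eq_take_append_four (l : List L) (i : ℕ) (h : i + 3 < l.length) :
    l = l.take i ++ ([l.getD i 1, l.getD (i + 1) 1, l.getD (i + 2) 1, l.getD (i + 3) 1] ++
      l.drop (i + 4)) := by
  conv_lhs => rw [← List.take_append_drop i l, List.drop_eq_getElem_cons (by omega : i < l.length),
    List.drop_eq_getElem_cons (by omega : i + 1 < l.length),
    List.drop_eq_getElem_cons (by omega : i + 2 < l.length), List.drop_eq_getElem_cons h]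
  simp [List.getD_eq_getElem?_getD, h, (by omega : i < l.length), (by omega : i + 1 < l.length),
    (by omega : i + 2 < l.length)]

end Lists

/-! ### Surjectivity: shortening words in the free Kuratowski monoid -/

section Reduction

variable {L : Type*} [LinearOrder L] [One L]

namespace FreeKuratowskiMonoid

theorem mul_le_mul_of_le {a b c d : FreeKuratowskiMonoid L} (h : a ≤ b) (k : c ≤ d) :
    a * c ≤ b * d := by
  obtain ⟨a, rfl⟩ := q_surjective a
  obtain ⟨b, rfl⟩ := q_surjective b
  obtain ⟨c, rfl⟩ := q_surjective c
  obtain ⟨d, rfl⟩ := q_surjective d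
  exact WordLE.trans (WordLE.mul_right c h) (WordLE.mul_left b k)

/-- The class of a one-letter word. -/
def letterClass (x : L) : FreeKuratowskiMonoid L := q L (FreeSemigroup.of x)

theorem letterClass_mono {x y : L} (h : x ≤ y) : letterClass x ≤ letterClass y := WordLE.of_le h

theorem letterClass_le_one {x : L} (h : x ≤ 1) : letterClass x ≤ 1 := letterClass_mono h

theorem one_le_letterClass {x : L} (h : 1 ≤ x) : 1 ≤ letterClass x := letterClass_mono h

theorem letterClass_mul_self (x : L) : letterClass x * letterClass x = letterClass x := by
  rw [letterClass, ← map_mul]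
  exact q_eq_q.2 ⟨.sq_le x, .le_sq x⟩

/-- The class of a list of letters. -/
def listClass (l : List L) : FreeKuratowskiMonoid L := (l.map letterClass).prod

theorem listClass_append (l l' : List L) : listClass (l ++ l') = listClass l * listClass l' := by
  simp [listClass]

theorem listClass_toList (w : FreeSemigroup L) : listClass (toList w) = q L w := by
  induction w using FreeSemigroup.recOnMul with
  | ih1 x => simp [toList, listClass, letterClass]
  | ih2 x y hx hy => rw [map_mul, ← hx, ← hy, toList_mul, listClass_append]

theorem q_ofList (l : List L) : q L (ofList l) = listClass l := by
  cases l with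
  | nil => rfl
  | cons x l => rw [← listClass_toList]; rfl

end FreeKuratowskiMonoid

open FreeKuratowskiMonoid

/-- The letter `z` lies weakly between `x` and the unit. -/
def WeakInner (z x : L) : Prop := (x ≤ z ∧ z ≤ 1) ∨ (1 ≤ z ∧ z ≤ x)

/-- One inequality compares `z` with the unit, the other compares `z` with `x` and uses idempotence.
-/
theorem WeakInner.mul_left {x z : L} (h : WeakInner z x) :
    letterClass z * letterClass x = letterClass x := by
  rcases h with ⟨h, k⟩ | ⟨k, h⟩
  · apply le_antisymm
    · simpa using mul_le_mul_of_le (letterClass_le_one k) (le_refl (letterClass x))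
    · simpa [letterClass_mul_self] using
        mul_le_mul_of_le (letterClass_mono h) (le_refl (letterClass x))
  · apply le_antisymm
    · simpa [letterClass_mul_self] using
        mul_le_mul_of_le (letterClass_mono h) (le_refl (letterClass x))
    · simpa using mul_le_mul_of_le (one_le_letterClass k) (le_refl (letterClass x))

theorem WeakInner.mul_right {x z : L} (h : WeakInner z x) :
    letterClass x * letterClass z = letterClass x := by
  rcases h with ⟨h, k⟩ | ⟨k, h⟩
  · apply le_antisymm
    · simpa using mul_le_mul_of_le (le_refl (letterClass x)) (letterClass_le_one k)
    · simpa [letterClass_mul_self] using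
        mul_le_mul_of_le (le_refl (letterClass x)) (letterClass_mono h)
  · apply le_antisymm
    · simpa [letterClass_mul_self] using
        mul_le_mul_of_le (le_refl (letterClass x)) (letterClass_mono h)
    · simpa using mul_le_mul_of_le (le_refl (letterClass x)) (one_le_letterClass k)

theorem weakInner_of_not_opp {x y : L} (h : ¬ Opp x y) : WeakInner x y ∨ WeakInner y x := by
  simp only [Opp, WeakInner] at *
  grind

theorem exists_letterClass_mul_eq_of_not_opp {x y : L} (h : ¬ Opp x y) :
    ∃ z, letterClass x * letterClass y = letterClass z := by
  rcases weakInner_of_not_opp h with h | h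
  · exact ⟨y, h.mul_left⟩
  · exact ⟨x, h.mul_right⟩

/-- Replacing `y` or `z` by `1` yields `xt` by absorption. As `y` and `z` lie on opposite sides of
the unit, one replacement increases the product and the other decreases it. -/
theorem mul_mul_mul_eq_of_weakInner {x y z t : L} (h : Opp y z) (hz : WeakInner z x)
    (hy : WeakInner y t) :
    letterClass x * letterClass y * letterClass z * letterClass t =
      letterClass x * letterClass t := by
  have e₁ : letterClass x * 1 * letterClass z * letterClass t =
      letterClass x * letterClass t := by rw [mul_one, hz.mul_right]
  have e₂ : letterClass x * letterClass y * 1 * letterClass t =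
      letterClass x * letterClass t := by rw [mul_one, mul_assoc, hy.mul_left]
  have m₁ {a b : FreeKuratowskiMonoid L} (hab : a ≤ b) :
      letterClass x * a * letterClass z * letterClass t ≤
        letterClass x * b * letterClass z * letterClass t :=
    mul_le_mul_of_le (mul_le_mul_of_le (mul_le_mul_of_le le_rfl hab) le_rfl) le_rfl
  have m₂ {a b : FreeKuratowskiMonoid L} (hab : a ≤ b) :
      letterClass x * letterClass y * a * letterClass t ≤
        letterClass x * letterClass y * b * letterClass t :=
    mul_le_mul_of_le (mul_le_mul_of_le le_rfl hab) le_rfl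
  rcases h with h | h
  · exact le_antisymm (e₁ ▸ m₁ (letterClass_le_one h.1.le)) (e₂ ▸ m₂ (one_le_letterClass h.2.le))
  · exact le_antisymm (e₂ ▸ m₂ (letterClass_le_one h.1.le)) (e₁ ▸ m₁ (one_le_letterClass h.2.le))

theorem inner_of_not_weakInner {x y z : L} (hx : Opp x y) (hy : Opp y z) (h : ¬ WeakInner x z) :
    Inner z x := by
  simp only [Opp, WeakInner, Inner] at *
  grind

theorem inner_or_eq_of_not_inner {x y z : L} (hx : Opp x y) (hy : Opp y z) (h : ¬ Inner x z) :
    WeakInner z x ∧ (Inner z x ∨ x = z) := by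
  simp only [Opp, WeakInner, Inner] at *
  grind

/-- Let `k` be the first index at which the step from `k` to `k + 2` fails to move outward. That
step is then weakly inward, and by `h` each weakly inward step forces the next one to be strictly
inward. The step at `k` itself may be strict (`V`), an equality (`W`), or run past the end (`V`). -/
theorem isVSeq_or_isWSeq {c : ℕ → L} {n : ℕ} (hn : 0 < n) (ha : AltSeq c n)
    (h : ∀ i, i + 3 ≤ n → WeakInner (c (i + 2)) (c i) → ¬ WeakInner (c (i + 1)) (c (i + 3))) :
    IsVSeq c n ∨ IsWSeq c n := by
  classical
  have hex : ∃ k, ¬ (k + 2 ≤ n ∧ Inner (c k) (c (k + 2))) := ⟨n, by omega⟩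
  obtain ⟨k, hk, hmin⟩ : ∃ k, ¬ (k + 2 ≤ n ∧ Inner (c k) (c (k + 2))) ∧
      ∀ i < k, i + 2 ≤ n ∧ Inner (c i) (c (i + 2)) :=
    ⟨Nat.find hex, Nat.find_spec hex, fun i hi => not_not.1 (Nat.find_min hex hi)⟩
  have hout : Outward c (k + 1) := fun i hi => (hmin i (by omega)).2
  have hkn : k < n := by
    rcases Nat.eq_zero_or_pos k with rfl | hk'
    · exact hn
    · have := (hmin (k - 1) (by omega)).1
      omega
  have hstep (i : ℕ) (hi : i + 3 ≤ n) (hw : WeakInner (c (i + 2)) (c i)) :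
      Inner (c (i + 3)) (c (i + 1)) :=
    inner_of_not_weakInner (ha (i + 1) (by omega)) (ha (i + 2) (by omega)) (h i hi hw)
  have hin (j : ℕ) : k + 1 + j + 2 ≤ n → Inner (c (k + 1 + j + 2)) (c (k + 1 + j)) := by
    induction j with
    | zero =>
      intro hj
      exact hstep k hj (inner_or_eq_of_not_inner (ha k (by omega)) (ha (k + 1) (by omega))
        fun h' => hk ⟨by omega, h'⟩).1
    | succ j ih =>
      intro hj
      refine hstep (k + 1 + j) hj ?_
      exact (ih (by omega)).imp (fun h => ⟨h.1.le, h.2.le⟩) (fun h => ⟨h.1.le, h.2.le⟩)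
  have hin' : Inward c (k + 1) n := by
    intro i hi hi'
    obtain ⟨j, rfl⟩ := Nat.exists_eq_add_of_le hi
    exact hin j hi'
  by_cases hk2 : k + 2 ≤ n
  · rcases (inner_or_eq_of_not_inner (ha k (by omega)) (ha (k + 1) (by omega))
        fun h' => hk ⟨by omega, h'⟩).2 with h' | h'
    · refine .inl ⟨ha, k, hkn, hout, fun i hi hi' => ?_⟩
      rcases hi.eq_or_lt with rfl | hi
      · exact h'
      · exact hin' i hi hi'
    · exact .inr ⟨ha, k, hk2, h', hout, hin'⟩
  · exact .inl ⟨ha, k, hkn, hout, fun i hi hi' => by omega⟩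

theorem exists_kuratowskiWord_of_list (l : List L) :
    ∃ w ∈ kuratowskiWords L, q L w = listClass l := by
  induction hn : l.length using Nat.strong_induction_on generalizing l with
  | _ n ih =>
  subst hn
  -- Otherwise `l` is of minimal length in its class, and any applicable reduction is a
  -- contradiction.
  by_cases hred : ∃ l' : List L, l'.length < l.length ∧ listClass l' = listClass l
  · obtain ⟨l', hlt, he⟩ := hred
    rw [← he]
    exact ih _ hlt l' rfl
  push Not at hred
  refine ⟨ofList l, ?_, q_ofList l⟩
  match l, hred with
  | [], _ => exact mem_kuratowskiWords.2 (.inl ⟨1, rfl⟩)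
  | [x], _ => exact mem_kuratowskiWords.2 (.inl ⟨x, rfl⟩)
  | x :: y :: l, hred =>
    have ha : AltSeq (letter (ofList (x :: y :: l))) (lastIdx (ofList (x :: y :: l))) := by
      intro i hi
      by_contra hopp
      obtain ⟨z, hz⟩ := exists_letterClass_mul_eq_of_not_opp hopp
      have hi' : i + 1 < (x :: y :: l).length := by simpa [lastIdx, ofList] using hi
      refine hred ((x :: y :: l).take i ++ ([z] ++ (x :: y :: l).drop (i + 2))) ?_ ?_
      · simp only [List.length_append, List.length_take, List.length_drop, List.length_singleton]
        omega
      · conv_rhs => rw [eq_take_append_two _ i hi']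
        rw [letter_eq] at hz
        rw [listClass_append, listClass_append, listClass_append, listClass_append]
        congr 2
        simp only [listClass, List.map_cons, List.map_nil, List.prod_cons, List.prod_nil, mul_one]
        exact hz.symm
    refine mem_kuratowskiWords.2 (.inr (isVSeq_or_isWSeq ?_ ha ?_))
    · simp [lastIdx, ofList]
    · intro i hi hz hy
      have hi' : i + 3 < (x :: y :: l).length := by
        simp only [lastIdx, ofList, List.length_cons] at hi ⊢
        omega
      refine hred ((x :: y :: l).take i ++
        ([(x :: y :: l).getD i 1, (x :: y :: l).getD (i + 3) 1] ++ (x :: y :: l).drop (i + 4))) ?_ ?_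
      · simp only [List.length_append, List.length_take, List.length_drop, List.length_cons,
          List.length_nil] at hi' ⊢
        omega
      · conv_rhs => rw [eq_take_append_four _ i hi']
        rw [listClass_append, listClass_append, listClass_append, listClass_append]
        congr 2
        have := mul_mul_mul_eq_of_weakInner
          (ha (i + 1) (by omega)) hz hy
        simp only [listClass, List.map_cons, List.map_nil, List.prod_cons, List.prod_nil, mul_one]
        rw [← mul_assoc, ← mul_assoc]
        exact this.symm

theorem q_surjOn : Set.SurjOn (q L) (kuratowskiWords L) Set.univ := by
  intro a _
  obtain ⟨u, rfl⟩ := q_surjective a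
  obtain ⟨w, hw, h⟩ := exists_kuratowskiWord_of_list (toList u)
  exact ⟨w, hw, h.trans (listClass_toList u)⟩

end Reduction

/-! ### Invariants: first and last nonzero signs -/

section FirstSign

variable {L : Type*}

/-- The first nonzero sign attached by `f` to the letters of a list, or `0` if there is none. -/
def firstSign (f : L → SignType) : List L → SignType
  | [] => 0
  | x :: l => if f x = 0 then firstSign f l else f x

theorem firstSign_append (f : L → SignType) (l l' : List L) :
    firstSign f (l ++ l') = if firstSign f l = 0 then firstSign f l' else firstSign f l := by
  induction l with
  | nil => simp [firstSign]
  | cons x l ih =>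
    by_cases h : f x = 0
    · simpa [firstSign, h] using ih
    · simp [firstSign, h]

theorem firstSign_eq_zero_iff {f : L → SignType} {l : List L} :
    firstSign f l = 0 ↔ ∀ x ∈ l, f x = 0 := by
  induction l with
  | nil => simp [firstSign]
  | cons x l ih =>
    by_cases h : f x = 0
    · simp [firstSign, h, ih]
    · simp [firstSign, h]

theorem firstSign_congr {f g : L → SignType} {l : List L} (h : ∀ x ∈ l, f x = g x) :
    firstSign f l = firstSign g l := by
  induction l with
  | nil => rfl
  | cons x l ih =>
    simp only [List.forall_mem_cons] at h
    simp [firstSign, h.1, ih h.2]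

theorem firstSign_append_mono (f : L → SignType) {u v u' v' : List L}
    (h : firstSign f u ≤ firstSign f v) (h' : firstSign f u' ≤ firstSign f v') :
    firstSign f (u ++ u') ≤ firstSign f (v ++ v') := by
  rw [firstSign_append, firstSign_append]
  -- Only four signs matter from here on, so the claim is a finite check.
  generalize firstSign f u = a at *
  generalize firstSign f v = b at *
  generalize firstSign f u' = c at *
  generalize firstSign f v' = d at *
  revert a b c d
  decide

variable [LinearOrder L]

/-- The sign of a letter that is farther than `s` or `t` from the unit. -/
def thresholdSign (s t : L) (x : L) : SignType := if x < s then -1 else if t < x then 1 else 0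

theorem thresholdSign_mono {s t : L} (h : s ≤ t) : Monotone (thresholdSign s t) := by
  intro x y hxy
  unfold thresholdSign
  split_ifs <;> first | decide | (exfalso; order)

variable [One L]

/-- The letter `1` is invisible to `f` and doubling a letter changes no first sign, so the
generating pairs are respected; concatenation is handled by `firstSign_append_mono`. The reversed
list records the last nonzero sign. -/
theorem WordLE.firstSign_le {u v : FreeSemigroup L} (h : WordLE u v) {f : L → SignType}
    (hf : Monotone f) (h1 : f 1 = 0) :
    firstSign f (toList u) ≤ firstSign f (toList v) ∧
      firstSign f (toList u).reverse ≤ firstSign f (toList v).reverse := by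
  induction h with
  | of_le h =>
    have := hf h
    constructor <;> simp only [toList, FreeSemigroup.of, List.reverse_singleton, firstSign] <;>
      split_ifs <;> simp_all
  | refl u => exact ⟨le_rfl, le_rfl⟩
  | trans _ _ ih ih' => exact ⟨ih.1.trans ih'.1, ih.2.trans ih'.2⟩
  | mul_right w _ ih =>
    simp only [toList_mul, List.reverse_append]
    exact ⟨firstSign_append_mono f ih.1 le_rfl, firstSign_append_mono f le_rfl ih.2⟩
  | mul_left w _ ih =>
    simp only [toList_mul, List.reverse_append]
    exact ⟨firstSign_append_mono f le_rfl ih.1, firstSign_append_mono f ih.2 le_rfl⟩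
  | le_mul_one x | le_one_mul x | mul_one_le x | one_mul_le x | le_sq x | sq_le x =>
    by_cases h : f x = 0 <;> simp [toList, FreeSemigroup.of, firstSign, h, h1]

/-- A list of letters on alternating sides of the unit that moves away from the unit. -/
inductive Asc : List L → Prop
  | nil : Asc []
  | single {x : L} : x ≠ 1 → Asc [x]
  | pair {x y : L} : Opp x y → Asc [x, y]
  | cons {x y z : L} {l : List L} : Opp x y → Inner x z → Asc (y :: z :: l) → Asc (x :: y :: z :: l)

theorem Asc.head_ne_one {x : L} {l : List L} (h : Asc (x :: l)) : x ≠ 1 := by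
  cases h with
  | single h => exact h
  | pair h => exact h.ne_one
  | cons h => exact h.ne_one

theorem Asc.tail {x : L} {l : List L} (h : Asc (x :: l)) : Asc l := by
  cases h with
  | single h => exact .nil
  | pair h => exact .single h.symm.ne_one
  | cons _ _ h => exact h

theorem Asc.opp {x y : L} {l : List L} (h : Asc (x :: y :: l)) : Opp x y := by
  cases h with
  | pair h => exact h
  | cons h => exact h

theorem Asc.inner_or {x y : L} {l : List L} (h : Asc (x :: y :: l)) :
    ∀ z ∈ l, Inner x z ∨ Inner y z := by
  induction l generalizing x y with
  | nil => simp
  | cons z l ih =>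
    cases h with
    | cons _ hi h =>
      simp only [List.forall_mem_cons]
      exact ⟨.inl hi, fun t ht => (ih h t ht).symm.imp hi.trans id⟩

theorem Asc.opp_or_inner {x : L} {l : List L} (h : Asc (x :: l)) :
    ∀ z ∈ l, Opp x z ∨ Inner x z := by
  cases l with
  | nil => simp
  | cons y l =>
    simp only [List.forall_mem_cons]
    refine ⟨.inl h.opp, fun z hz => (h.inner_or z hz).symm.imp (fun k => ?_) id⟩
    have := h.opp
    simp only [Opp, Inner] at *
    grind

/-- If the heads differ, a threshold at the one nearer to the unit, or at the unit itself when they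
are on opposite sides, separates the lists. On the same side the farther head is seen with its sign,
the nearer one is not seen, and the letter after the nearer one, if any, has the other sign. -/
theorem Asc.head_eq {x y : L} {l l' : List L} (h : Asc (x :: l)) (h' : Asc (y :: l'))
    (hF : ∀ f : L → SignType, Monotone f → f 1 = 0 →
      firstSign f (x :: l) = firstSign f (y :: l')) : x = y := by
  wlog hxy : x < y generalizing x y l l'
  · rcases (not_lt.1 hxy).lt_or_eq with k | k
    · exact (this h' h (fun f hf hf1 => (hF f hf hf1).symm) k).symm
    · exact k.symm
  exfalso
  rcases lt_or_ge y 1 with hy | hy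
  · have := hF (thresholdSign y 1) (thresholdSign_mono hy.le) (by simp [thresholdSign, hy.le])
    cases l' with
    | nil => simp [firstSign, thresholdSign, hxy, hy.not_gt] at this
    | cons z l' =>
      have hz := h'.opp.neg_iff.1 hy
      simp [firstSign, thresholdSign, hxy, hy.not_gt, hz, (hy.trans hz).not_gt] at this
  rcases lt_or_ge x 1 with hx | hx
  · have := hF (thresholdSign 1 1) (thresholdSign_mono le_rfl) (by simp [thresholdSign])
    simp [firstSign, thresholdSign, hx, hy.not_gt, hy.lt_of_ne' h'.head_ne_one] at this
  · have hx' := hx.lt_of_ne' h.head_ne_one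
    have := hF (thresholdSign 1 x) (thresholdSign_mono hx) (by simp [thresholdSign, hx])
    cases l with
    | nil => simp [firstSign, thresholdSign, hxy, hx.not_gt, hy.not_gt] at this
    | cons z l =>
      have hz := h.opp.pos_iff.1 hx'
      simp [firstSign, thresholdSign, hxy, hx.not_gt, hy.not_gt, hz] at this

open scoped Classical in
theorem Asc.ext {l l' : List L} (h : Asc l) (h' : Asc l')
    (hF : ∀ f : L → SignType, Monotone f → f 1 = 0 → firstSign f l = firstSign f l') : l = l' := by
  have key {x : L} {l : List L} (h : Asc (x :: l)) :
      firstSign (thresholdSign 1 1) (x :: l) ≠ 0 := by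
    rw [Ne, firstSign_eq_zero_iff]
    intro k
    have := k x (by simp)
    have h1 := h.head_ne_one
    rcases lt_or_gt_of_ne h.head_ne_one with h1 | h1 <;>
      simp [thresholdSign, h1, h1.not_gt] at this
  have hm := thresholdSign_mono (le_refl (1 : L))
  induction l generalizing l' with
  | nil =>
    cases l' with
    | nil => rfl
    | cons y l' => exact absurd (hF _ hm (by simp [thresholdSign])).symm (key h')
  | cons x l ih =>
    cases l' with
    | nil => exact absurd (hF _ hm (by simp [thresholdSign])) (key h)
    | cons y l' =>
      obtain rfl := h.head_eq h' hF
      congr 1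
      refine ih h.tail h'.tail fun f hf hf1 => ?_
      -- Making `f` vanish between the common head and the unit hides the head. The later letters
      -- are on the other side of the unit or beyond `x`, so their signs do not change.
      let g : L → SignType := fun z => if z ∈ Set.uIcc x 1 then 0 else f z
      have hgx : g x = 0 := by simp [g]
      have hg1 : g 1 = 0 := by simp [g]
      have hg : Monotone g := by
        intro a b hab
        have := hf hab
        have h1 := @hf a 1
        have h2 := @hf 1 b
        rw [hf1] at h1 h2
        simp only [g, Set.mem_uIcc]
        split_ifs <;> grind
      have hgf {l : List L} (h : Asc (x :: l)) : firstSign g l = firstSign f l := by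
        refine firstSign_congr fun z hz => if_neg ?_
        have := h.opp_or_inner z hz
        simp only [Opp, Inner, Set.mem_uIcc] at *
        grind
      have := hF g hg hg1
      simp only [firstSign, hgx, if_true] at this
      rwa [hgf h, hgf h'] at this

end FirstSign

/-! ### Injectivity: Kuratowski words from two halves -/

section Glue

variable {L : Type*} [LinearOrder L] [One L]

/-- A list of letters on alternating sides of the unit that moves towards the unit. -/
def Desc (l : List L) : Prop :=
  AltSeq (fun i => l.getD i 1) (l.length - 1) ∧ Inward (fun i => l.getD i 1) 0 (l.length - 1)

theorem desc_pair {x y : L} : Desc [x, y] ↔ Opp x y := by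
  constructor
  · exact fun h => h.1 0 (by simp)
  · intro h
    refine ⟨fun i hi => ?_, fun i _ hi => ?_⟩
    · obtain rfl : i = 0 := by simpa using hi
      exact h
    · simp at hi

theorem desc_cons {x y z : L} {l : List L} :
    Desc (x :: y :: z :: l) ↔ Opp x y ∧ Inner z x ∧ Desc (y :: z :: l) := by
  constructor
  · intro h
    refine ⟨h.1 0 (by simp), h.2 0 le_rfl (by simp), fun i hi => ?_, fun i _ hi => ?_⟩
    · exact h.1 (i + 1) (by simp at *; omega)
    · exact h.2 (i + 1) (by omega) (by simp at *; omega)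
  · rintro ⟨h, k, h'⟩
    refine ⟨fun i hi => ?_, fun i _ hi => ?_⟩
    · cases i with
      | zero => exact h
      | succ i => exact h'.1 i (by simp at *; omega)
    · cases i with
      | zero => exact k
      | succ i => exact h'.2 i (by omega) (by simp at *; omega)

theorem Desc.opp {x y : L} {l : List L} (h : Desc (x :: y :: l)) : Opp x y := h.1 0 (by simp)

theorem Desc.inner_or {x y : L} {l : List L} (h : Desc (x :: y :: l)) :
    ∀ z ∈ l, Inner z x ∨ Inner z y := by
  induction l generalizing x y with
  | nil => simp
  | cons z l ih =>
    obtain ⟨-, hi, h⟩ := desc_cons.1 h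
    simp only [List.forall_mem_cons]
    exact ⟨.inl hi, fun t ht => (ih h t ht).symm.imp (fun k => k.trans hi) id⟩

theorem asc_of_altSeq {l : List L} (h2 : 2 ≤ l.length)
    (ha : AltSeq (fun i => l.getD i 1) (l.length - 1))
    (ho : Outward (fun i => l.getD i 1) (l.length - 1)) : Asc l := by
  induction l with
  | nil => simp at h2
  | cons x l ih =>
    match l, ih with
    | [], _ => simp at h2
    | [y], _ => exact .pair (ha 0 (by simp))
    | y :: z :: l, ih =>
      refine .cons (ha 0 (by simp)) (ho 0 (by simp)) (ih (by simp) (fun i hi => ?_) fun i hi => ?_)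
      · exact ha (i + 1) (by simp at *; omega)
      · exact ho (i + 1) (by simp at *; omega)

theorem Desc.asc_reverse {l : List L} (h2 : 2 ≤ l.length) (h : Desc l) : Asc l.reverse := by
  refine asc_of_altSeq (by simpa) (fun i hi => ?_) fun i hi => ?_
  · rw [List.length_reverse] at hi
    beta_reduce
    rw [List.getD_reverse _ (by omega), List.getD_reverse _ (by omega)]
    have := h.1 (l.length - 1 - (i + 1)) (by omega)
    rw [show l.length - 1 - (i + 1) + 1 = l.length - 1 - i by omega] at this
    exact this.symm
  · rw [List.length_reverse] at hi
    beta_reduce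
    rw [List.getD_reverse _ (by omega), List.getD_reverse _ (by omega)]
    have := h.2 (l.length - 1 - (i + 2)) (by omega) (by omega)
    rwa [show l.length - 1 - (i + 2) + 2 = l.length - 1 - i by omega] at this

/-- A sequence is cut into its part up to `t`, read backwards, and its part from `s` on. -/
theorem desc_and_desc_iff {c : ℕ → L} {n s t : ℕ} {l r : List L} (hst : s ≤ t) (htn : t ≤ n)
    (hl : l.length = t + 1) (hlc : ∀ i ≤ t, c i = l.getD (t - i) 1)
    (hr : n + 1 = s + r.length) (hrc : ∀ i, c (s + i) = r.getD i 1) :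
    Desc l ∧ Desc r ↔ AltSeq c n ∧ Outward c t ∧ Inward c s n := by
  simp only [Desc, hl, Nat.add_sub_cancel, show r.length - 1 = n - s by omega, ← hrc]
  constructor
  · rintro ⟨⟨h₁, h₂⟩, h₃, h₄⟩
    refine ⟨fun i hi => ?_, fun i hi => ?_, fun i hi hi' => ?_⟩
    · by_cases hit : i < t
      · rw [hlc i hit.le, hlc (i + 1) hit]
        have := h₁ (t - (i + 1)) (by omega)
        rw [show t - (i + 1) + 1 = t - i by omega] at this
        exact this.symm
      · obtain ⟨j, rfl⟩ := Nat.exists_eq_add_of_le (show s ≤ i by omega)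
        exact h₃ j (by omega)
    · rw [hlc i (by omega), hlc (i + 2) hi]
      have := h₂ (t - (i + 2)) (by omega) (by omega)
      rwa [show t - (i + 2) + 2 = t - i by omega] at this
    · obtain ⟨j, rfl⟩ := Nat.exists_eq_add_of_le hi
      exact h₄ j (by omega) (by omega)
  · rintro ⟨h₁, h₂, h₃⟩
    refine ⟨⟨fun i hi => ?_, fun i _ hi => ?_⟩, fun i hi => ?_, fun i _ hi => ?_⟩
    · have := h₁ (t - (i + 1)) (by omega)
      rw [hlc _ (by omega), hlc _ (by omega), show t - (t - (i + 1)) = i + 1 by omega,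
        show t - (t - (i + 1) + 1) = i by omega] at this
      exact this.symm
    · have := h₂ (t - (i + 2)) (by omega)
      rwa [hlc _ (by omega), hlc _ (by omega), show t - (t - (i + 2)) = i + 2 by omega,
        show t - (t - (i + 2) + 2) = i by omega] at this
    · exact h₁ (s + i) (by omega)
    · exact h₃ (s + i) (by omega) (by omega)

/-- The lists starting with the letters `a` and `b` in some order and moving towards the unit. -/
def Half (a b : L) : Set (List L) := {l | Desc l ∧ ∃ t, l = a :: b :: t ∨ l = b :: a :: t}

theorem Half.two_le_length {a b : L} {l : List L} (h : l ∈ Half a b) : 2 ≤ l.length := by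
  obtain ⟨-, t, rfl | rfl⟩ := h <;> simp

theorem Half.le_and_le {a b : L} (ha : a < 1) (hb : 1 < b) {l : List L} (h : l ∈ Half a b) :
    ∀ x ∈ l, a ≤ x ∧ x ≤ b := by
  have hab := ha.trans hb
  obtain ⟨h, t, rfl | rfl⟩ := h <;> simp only [List.forall_mem_cons] <;>
    refine ⟨⟨by order, by order⟩, ⟨by order, by order⟩, fun z hz => ?_⟩ <;>
    have := h.inner_or z hz <;> simp only [Inner] at this <;> grind

/-- The word with a given left half (read backwards) and right half, which may share one or two
letters. -/
def glue (l r : List L) : List L :=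
  l.reverse ++ if l.head? = r.head? then r.tail else r.tail.tail

theorem glue_reverse {a b : L} {l r : List L} (hl : l ∈ Half a b) (hr : r ∈ Half a b) :
    (glue l r).reverse = glue r l := by
  obtain ⟨-, t, rfl | rfl⟩ := hl <;> obtain ⟨-, s, rfl | rfl⟩ := hr <;> by_cases h : a = b <;>
    simp [glue, h, eq_comm]

/-- If no sign is seen in the left half, then `f a = f b = 0`; the letters of the right half lie in
`[a, b]`, so monotonicity makes `f` vanish there too. -/
theorem firstSign_glue {a b : L} (ha : a < 1) (hb : 1 < b) {l r : List L} (hl : l ∈ Half a b)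
    (hr : r ∈ Half a b) {f : L → SignType} (hf : Monotone f) :
    firstSign f (glue l r) = firstSign f l.reverse := by
  rw [glue, firstSign_append, ite_eq_right_iff]
  intro h
  rw [h]
  have hab : f a = 0 ∧ f b = 0 := by
    rw [firstSign_eq_zero_iff] at h
    obtain ⟨-, t, rfl | rfl⟩ := hl <;> exact ⟨h a (by simp), h b (by simp)⟩
  rw [firstSign_eq_zero_iff]
  intro x hx
  have hx' : x ∈ r := by
    split_ifs at hx
    · exact List.mem_of_mem_tail hx
    · exact List.mem_of_mem_tail (List.mem_of_mem_tail hx)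
  have := Half.le_and_le ha hb hr x hx'
  exact le_antisymm (hab.2 ▸ hf this.2) (hab.1 ▸ hf this.1)

theorem desc_iff_of_overlap_two {l z : List L} {p q : L} :
    Desc (p :: q :: l) ∧ Desc (q :: p :: z) ↔
      AltSeq (fun i => (l.reverse ++ q :: p :: z).getD i 1) (l.length + 1 + z.length) ∧
      Outward (fun i => (l.reverse ++ q :: p :: z).getD i 1) (l.length + 1) ∧
      Inward (fun i => (l.reverse ++ q :: p :: z).getD i 1) l.length (l.length + 1 + z.length) := by
  refine desc_and_desc_iff (by omega) (by omega) rfl (getD_reverse_append l z p q)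
    (by simp; omega) fun i => ?_
  rw [List.getD_append_right _ _ _ _ (by simp)]
  simp

theorem desc_iff_of_overlap_one {l z : List L} {p q : L} :
    Desc (p :: q :: l) ∧ Desc (p :: z) ↔
      AltSeq (fun i => (l.reverse ++ q :: p :: z).getD i 1) (l.length + 1 + z.length) ∧
      Outward (fun i => (l.reverse ++ q :: p :: z).getD i 1) (l.length + 1) ∧
      Inward (fun i => (l.reverse ++ q :: p :: z).getD i 1) (l.length + 1)
        (l.length + 1 + z.length) := by
  refine desc_and_desc_iff le_rfl (by omega) rfl (getD_reverse_append l z p q)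
    (by simp; omega) fun i => ?_
  rw [List.getD_append_right _ _ _ _ (by simp; omega), List.length_reverse,
    show l.length + 1 + i - l.length = i + 1 by omega, List.getD_cons_succ]

/-- Halves with the same first letter overlap in that letter, which becomes the centre of a
`W`-word. Halves with different first letters overlap in both extremal letters, which gives a
`V`-word. -/
theorem ofList_glue_mem {a b : L} (hab : a ≠ b) {l r : List L} (hl : l ∈ Half a b)
    (hr : r ∈ Half a b) : ofList (glue l r) ∈ kuratowskiWords L := by
  have hV {p q : L} {l z : List L} (hpq : p ≠ q) (hl : Desc (p :: q :: l))
      (hr : Desc (q :: p :: z)) :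
      ofList (glue (p :: q :: l) (q :: p :: z)) ∈ kuratowskiWords L := by
    have he : glue (p :: q :: l) (q :: p :: z) = l.reverse ++ q :: p :: z := by simp [glue, hpq]
    obtain ⟨h₁, h₂, h₃⟩ := desc_iff_of_overlap_two.1 ⟨hl, hr⟩
    rw [mem_kuratowskiWords, lastIdx_ofList, he, letter_ofList (by simp),
      show (l.reverse ++ q :: p :: z).length - 1 = l.length + 1 + z.length by simp; omega]
    exact .inr (.inl ⟨h₁, _, by omega, h₂, h₃⟩)
  have hW {p q : L} {l z : List L} (hl : Desc (p :: q :: l))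
      (hr : Desc (p :: q :: z)) :
      ofList (glue (p :: q :: l) (p :: q :: z)) ∈ kuratowskiWords L := by
    have he : glue (p :: q :: l) (p :: q :: z) = l.reverse ++ q :: p :: q :: z := by simp [glue]
    obtain ⟨h₁, h₂, h₃⟩ := desc_iff_of_overlap_one.1 ⟨hl, hr⟩
    rw [mem_kuratowskiWords, lastIdx_ofList, he, letter_ofList (by simp),
      show (l.reverse ++ q :: p :: q :: z).length - 1 = l.length + 1 + (q :: z).length by
        simp; omega]
    refine .inr (.inr ⟨h₁, l.length, by simp, ?_, h₂, h₃⟩)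
    beta_reduce
    rw [List.getD_append_right _ _ _ _ (by simp), List.getD_append_right _ _ _ _ (by simp)]
    simp
  obtain ⟨hl, t, rfl | rfl⟩ := hl <;> obtain ⟨hr, s, rfl | rfl⟩ := hr
  · exact hW hl hr
  · exact hV hab hl hr
  · exact hV hab.symm hl hr
  · exact hW hl hr

theorem exists_half {p q : L} (h : Opp p q) : ∃ a < (1 : L), ∃ b > (1 : L),
    ∀ t, (Desc (p :: q :: t) → p :: q :: t ∈ Half a b) ∧
      (Desc (q :: p :: t) → q :: p :: t ∈ Half a b) := by
  rcases h with h | h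
  · exact ⟨p, h.1, q, h.2, fun t => ⟨fun k => ⟨k, t, .inl rfl⟩, fun k => ⟨k, t, .inr rfl⟩⟩⟩
  · exact ⟨q, h.1, p, h.2, fun t => ⟨fun k => ⟨k, t, .inr rfl⟩, fun k => ⟨k, t, .inl rfl⟩⟩⟩

theorem exists_glue_of_mem {w : FreeSemigroup L} (h : w ∈ kuratowskiWords L) :
    (∃ x, w = FreeSemigroup.of x) ∨ ∃ a < 1, ∃ b > 1, ∃ l ∈ Half a b, ∃ r ∈ Half a b,
      w = ofList (glue l r) := by
  refine (mem_kuratowskiWords.1 h).imp id ?_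
  have hlast : lastIdx w + 1 = (toList w).length := rfl
  have key {m : ℕ} (hm : m < lastIdx w) : ∃ (l z : List L) (p q : L), l.length = m ∧
      toList w = l.reverse ++ q :: p :: z := by
    refine ⟨((toList w).take m).reverse, (toList w).drop (m + 2), (toList w).getD (m + 1) 1,
      (toList w).getD m 1, by simp; omega, ?_⟩
    rw [List.reverse_reverse]
    exact eq_take_append_two _ m (by omega)
  rintro (⟨ha, m, hm, ho, hi⟩ | ⟨ha, m, hm, he, ho, hi⟩)
  · obtain ⟨l, z, p, q, rfl, hw⟩ := key hm
    rw [letter_eq] at ha ho hi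
    rw [show lastIdx w = l.length + 1 + z.length by rw [hw] at hlast; simp at hlast; omega] at ha hi
    rw [hw] at ha ho hi
    obtain ⟨hl, hr⟩ := desc_iff_of_overlap_two.2 ⟨ha, ho, hi⟩
    obtain ⟨a, ha, b, hb, hh⟩ := exists_half hl.opp
    refine ⟨a, ha, b, hb, _, (hh _).1 hl, _, (hh _).2 hr, ?_⟩
    rw [← ofList_toList w, hw]
    have hpq : p ≠ q := by
      rintro rfl
      rcases hl.opp with h | h <;> exact (h.1.trans h.2).false
    simp [glue, hpq]
  · obtain ⟨l, z, p, q, rfl, hw⟩ := key (show m < lastIdx w by omega)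
    rw [letter_eq] at ha ho hi he
    rw [show lastIdx w = l.length + 1 + z.length by rw [hw] at hlast; simp at hlast; omega]
      at ha hi hm
    rw [hw] at ha ho hi he
    cases z with
    | nil => simp at hm
    | cons y z =>
      have hy : q = y := by
        beta_reduce at he
        rw [List.getD_append_right _ _ _ _ (by simp),
          List.getD_append_right _ _ _ _ (by simp)] at he
        simpa using he
      subst hy
      obtain ⟨hl, hr⟩ := desc_iff_of_overlap_one.2 ⟨ha, ho, hi⟩
      obtain ⟨a, ha, b, hb, hh⟩ := exists_half hl.opp
      refine ⟨a, ha, b, hb, _, (hh _).1 hl, _, (hh _).1 hr, ?_⟩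
      rw [← ofList_toList w, hw]
      simp [glue]

theorem two_le_length_glue {a b : L} {l r : List L} (hl : l ∈ Half a b) :
    2 ≤ (glue l r).length := by
  have := Half.two_le_length hl
  simp only [glue, List.length_append, List.length_reverse]
  omega

/-- The two halves of a Kuratowski word. -/
theorem exists_halves {w : FreeSemigroup L} (h : w ∈ kuratowskiWords L) :
    ∃ d e : List L, Asc d ∧ Asc e ∧ w = ofList (glue d.reverse e.reverse) ∧
      ∀ f : L → SignType, Monotone f → f 1 = 0 → firstSign f (toList w) = firstSign f d ∧
        firstSign f (toList w).reverse = firstSign f e := by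
  rcases exists_glue_of_mem h with ⟨x, rfl⟩ | ⟨a, ha, b, hb, l, hl, r, hr, rfl⟩
  -- The word `1` has empty halves, since `ofList []` is the word `1`; any other letter is both of
  -- its own halves.
  · by_cases hx : x = 1
    · subst hx
      refine ⟨[], [], .nil, .nil, by simp [glue, ofList], fun f _ h1 => ?_⟩
      simp [toList, FreeSemigroup.of, firstSign, h1]
    · exact ⟨[x], [x], .single hx, .single hx, by simp [glue]; rfl, fun f _ _ => ⟨rfl, rfl⟩⟩
  · refine ⟨l.reverse, r.reverse, hl.1.asc_reverse (Half.two_le_length hl),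
      hr.1.asc_reverse (Half.two_le_length hr), by simp, fun f hf _ => ?_⟩
    have hne : glue l r ≠ [] := by
      have := two_le_length_glue (r := r) hl
      rintro h
      simp [h] at this
    rw [toList_ofList hne, glue_reverse hl hr]
    exact ⟨firstSign_glue ha hb hl hr hf, firstSign_glue ha hb hr hl hf⟩

theorem q_injOn : Set.InjOn (FreeKuratowskiMonoid.q L) (kuratowskiWords L) := by
  intro u hu v hv huv
  obtain ⟨h, h'⟩ := FreeKuratowskiMonoid.q_eq_q.1 huv
  obtain ⟨d, e, hd, he, rfl, hf⟩ := exists_halves hu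
  obtain ⟨d', e', hd', he', rfl, hf'⟩ := exists_halves hv
  have hdd : d = d' := hd.ext hd' fun f hm h1 => by
    rw [← (hf f hm h1).1, ← (hf' f hm h1).1]
    exact le_antisymm (h.firstSign_le hm h1).1 (h'.firstSign_le hm h1).1
  have hee : e = e' := he.ext he' fun f hm h1 => by
    rw [← (hf f hm h1).2, ← (hf' f hm h1).2]
    exact le_antisymm (h.firstSign_le hm h1).2 (h'.firstSign_le hm h1).2
  rw [hdd, hee]

theorem q_bijOn : Set.BijOn (FreeKuratowskiMonoid.q L) (kuratowskiWords L) Set.univ :=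
  ⟨Set.mapsTo_univ _ _, q_injOn, q_surjOn⟩

end Glue

/-! ### Counting Kuratowski words -/

section Counting

-- On a downward closed chain the number of predecessors is injective with values below the size of
-- the chain, hence takes each such value once.
open scoped Classical in
theorem sum_card_rel_eq_sum_range {α : Type*} [Finite α] {r : α → α → Prop} (S : Finset α)
    (hirr : ∀ x, ¬ r x x) (htrans : ∀ x y z, r x y → r y z → r x z)
    (htri : ∀ x ∈ S, ∀ y ∈ S, x ≠ y → r x y ∨ r y x) (hdown : ∀ z ∈ S, ∀ w, r w z → w ∈ S)
    (g : ℕ → ℕ) :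
    ∑ z ∈ S, g (Nat.card {w // r w z}) = ∑ k ∈ Finset.range S.card, g k := by
  have := Fintype.ofFinite α
  have hc (z : α) : Nat.card {w // r w z} = (Finset.univ.filter fun w => r w z).card := by
    rw [Nat.card_eq_fintype_card, Fintype.card_subtype]
  have hlt {x y : α} (h : r x y) : Nat.card {w // r w x} < Nat.card {w // r w y} := by
    rw [hc, hc]
    refine Finset.card_lt_card (Finset.ssubset_iff_of_subset ?_ |>.2 ⟨x, by simpa, by simp [hirr]⟩)
    intro w hw
    simp only [Finset.mem_filter, Finset.mem_univ, true_and] at hw ⊢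
    exact htrans _ _ _ hw h
  have hinj : Set.InjOn (fun z => Nat.card {w // r w z}) S := by
    intro x hx y hy hxy
    by_contra hne
    rcases htri x hx y hy hne with h | h
    · exact (hlt h).ne hxy
    · exact (hlt h).ne' hxy
  have himg : S.image (fun z => Nat.card {w // r w z}) = Finset.range S.card := by
    refine Finset.eq_of_subset_of_card_le ?_ (by rw [Finset.card_image_of_injOn hinj]; simp)
    intro k hk
    obtain ⟨z, hz, rfl⟩ := Finset.mem_image.1 hk
    rw [Finset.mem_range, hc]
    refine Finset.card_lt_card (Finset.ssubset_iff_of_subset ?_ |>.2 ⟨z, hz, by simp [hirr]⟩)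
    intro w hw
    exact hdown z hz w (by simpa using hw)
  rw [← himg, Finset.sum_image hinj]

/-- The hockey-stick identity, in the form of the recursion for `Out`. -/
theorem one_add_sum_choose (n p : ℕ) :
    1 + ∑ k ∈ Finset.range n, (p + k + 1).choose p = (n + p + 1).choose n := by
  induction n with
  | zero => simp
  | succ n ih =>
    rw [Finset.sum_range_succ, ← add_assoc, ih, show n + 1 + p + 1 = (n + p + 1) + 1 by omega,
      Nat.choose_succ_succ, show p + n + 1 = n + p + 1 by omega]
    congr 1
    exact Nat.choose_symm_of_eq_add (by omega)

variable {L : Type*} [LinearOrder L] [One L]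

/-- The number of letters strictly between `x` and the unit. -/
noncomputable def depth (x : L) : ℕ := Nat.card {z // Inner z x}

/-- The lists that can be added after the letters `x` and `y` while moving towards the unit. -/
def Out (x y : L) : Type _ := {l : List L // Desc (x :: y :: l)}

/-- A nonempty element of `Out x y` is given by its first letter and the remaining list. -/
def outEquiv {x y : L} (h : Opp x y) : Out x y ≃ Option (Σ z : {z // Inner z x}, Out y z) where
  toFun
    | ⟨[], _⟩ => none
    | ⟨z :: l, hl⟩ => some ⟨⟨z, (desc_cons.1 hl).2.1⟩, ⟨l, (desc_cons.1 hl).2.2⟩⟩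
  invFun
    | none => ⟨[], desc_pair.2 h⟩
    | some ⟨z, l⟩ => ⟨z :: l.1, desc_cons.2 ⟨h, z.2, l.2⟩⟩
  left_inv := by rintro ⟨_ | ⟨z, l⟩, hl⟩ <;> rfl
  right_inv := by rintro (_ | ⟨z, l⟩) <;> rfl

theorem inner_tri {x y z : L} (hx : Inner x z) (hy : Inner y z) (h : x ≠ y) :
    Inner x y ∨ Inner y x := by
  simp only [Inner] at *
  grind

open scoped Classical in
theorem sum_depth_eq_sum_range [Finite L] {P : L → Prop} [Fintype {z // P z}]
    (htri : ∀ x y, P x → P y → x ≠ y → Inner x y ∨ Inner y x) (hdown : ∀ z w, P z → Inner w z → P w)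
    (g : ℕ → ℕ) :
    ∑ z : {z // P z}, g (depth z.1) = ∑ k ∈ Finset.range (Nat.card {z // P z}), g k := by
  have := Fintype.ofFinite L
  have := sum_card_rel_eq_sum_range (r := Inner) (Finset.univ.filter P)
    (fun _ h => h.irrefl) (fun _ _ _ h k => h.trans k)
    (fun y hy z hz => htri y z (by simpa using hy) (by simpa using hz))
    (fun z hz w h => by
      simp only [Finset.mem_filter, Finset.mem_univ, true_and] at hz ⊢
      exact hdown z w hz h) g
  rw [Nat.card_eq_fintype_card, Fintype.card_subtype, ← this]
  exact (Finset.sum_subtype _ (by simp) (fun z => g (depth z))).symm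

theorem depth_lt [Finite L] {x z : L} (h : Inner z x) : depth z < depth x := by
  have := Fintype.ofFinite L
  classical
  rw [depth, depth, Nat.card_eq_fintype_card, Nat.card_eq_fintype_card, Fintype.card_subtype,
    Fintype.card_subtype]
  refine Finset.card_lt_card (Finset.ssubset_iff_of_subset ?_ |>.2
    ⟨z, by simpa, by simpa using fun h : Inner z z => h.irrefl⟩)
  intro w hw
  simp only [Finset.mem_filter, Finset.mem_univ, true_and] at hw ⊢
  exact hw.trans h

/-- By `outEquiv` the count `N(i, j)` for depths `i`, `j` satisfies `N(i, j) = 1 + ∑_{k<i} N(j, k)`,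
because the depths of the letters inside `x` are exactly `0, …, i - 1`. -/
theorem finite_and_card_out [Finite L] {x y : L} (h : Opp x y) :
    Finite (Out x y) ∧ Nat.card (Out x y) = (depth x + depth y + 1).choose (depth x) := by
  induction hn : depth x + depth y using Nat.strong_induction_on generalizing x y with
  | _ n ih =>
  have := Fintype.ofFinite L
  classical
  have ih' (z : {z // Inner z x}) : Finite (Out y z.1) ∧
      Nat.card (Out y z.1) = (depth y + depth z.1 + 1).choose (depth y) :=
    ih _ (by have := depth_lt z.2; omega) (h.of_inner z.2).symm rfl
  have hfin (z : {z // Inner z x}) : Finite (Out y z.1) := (ih' z).1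
  refine ⟨.of_equiv _ (outEquiv h).symm, ?_⟩
  rw [Nat.card_congr (outEquiv h), Finite.card_option, Nat.card_sigma]
  simp only [(ih' _).2]
  rw [sum_depth_eq_sum_range (fun _ _ => inner_tri) (fun _ _ h k => k.trans h)
    (fun k => (depth y + k + 1).choose (depth y)), add_comm,
    ← depth, one_add_sum_choose, hn]

/-- An element of `Half a b` starts with `a, b` or with `b, a`. -/
noncomputable def outSumOutEquiv {a b : L} (hab : a ≠ b) : Out a b ⊕ Out b a ≃ Half a b := by
  refine Equiv.ofBijective (Sum.elim (fun l => ⟨a :: b :: l.1, l.2, _, .inl rfl⟩)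
    (fun l => ⟨b :: a :: l.1, l.2, _, .inr rfl⟩)) ⟨?_, ?_⟩
  · rintro (⟨l, hl⟩ | ⟨l, hl⟩) (⟨l', hl'⟩ | ⟨l', hl'⟩) h <;> cases congrArg Subtype.val h <;>
      first | rfl | exact absurd rfl hab
  · rintro ⟨_, hl, t, rfl | rfl⟩
    · exact ⟨.inl ⟨t, hl⟩, rfl⟩
    · exact ⟨.inr ⟨t, hl⟩, rfl⟩

theorem finite_half [Finite L] {a b : L} (ha : a < 1) (hb : 1 < b) : Finite (Half a b) := by
  have := (finite_and_card_out (.inl ⟨ha, hb⟩ : Opp a b)).1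
  have := (finite_and_card_out (.inr ⟨ha, hb⟩ : Opp b a)).1
  exact .of_equiv _ (outSumOutEquiv (ha.trans hb).ne)

theorem card_half [Finite L] {a b : L} (ha : a < 1) (hb : 1 < b) :
    Nat.card (Half a b) = (depth a + 1 + (depth b + 1)).choose (depth a + 1) := by
  obtain ⟨_, h⟩ := finite_and_card_out (.inl ⟨ha, hb⟩ : Opp a b)
  obtain ⟨_, h'⟩ := finite_and_card_out (.inr ⟨ha, hb⟩ : Opp b a)
  rw [← Nat.card_congr (outSumOutEquiv (ha.trans hb).ne), Nat.card_sum, h, h',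
    show depth a + 1 + (depth b + 1) = (depth a + depth b + 1) + 1 by omega,
    -- Pascal's rule merges the halves starting with `a` and those starting with `b`.
    Nat.choose_succ_succ, add_comm (depth b)]
  congr 1
  exact Nat.choose_symm_of_eq_add (by omega)

/-- The left half is recovered from first signs by `Asc.ext`; reversing the word exchanges the two
halves. -/
theorem half_glue_injective {a b a' b' : L} (ha : a < 1) (hb : 1 < b) (ha' : a' < 1) (hb' : 1 < b')
    {l r l' r' : List L} (hl : l ∈ Half a b) (hr : r ∈ Half a b) (hl' : l' ∈ Half a' b')
    (hr' : r' ∈ Half a' b') (h : glue l r = glue l' r') : l = l' ∧ r = r' := by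
  have key {a b a' b' : L} (ha : a < 1) (hb : 1 < b) (ha' : a' < 1) (hb' : 1 < b')
      {l r l' r' : List L} (hl : l ∈ Half a b) (hr : r ∈ Half a b) (hl' : l' ∈ Half a' b')
      (hr' : r' ∈ Half a' b') (h : glue l r = glue l' r') : l = l' := by
    refine List.reverse_injective ((hl.1.asc_reverse (Half.two_le_length hl)).ext
      (hl'.1.asc_reverse (Half.two_le_length hl')) fun f hf _ => ?_)
    rw [← firstSign_glue ha hb hl hr hf, h, firstSign_glue ha' hb' hl' hr' hf]
  refine ⟨key ha hb ha' hb' hl hr hl' hr' h, key ha hb ha' hb' hr hl hr' hl' ?_⟩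
  rw [← glue_reverse hl hr, h, glue_reverse hl' hr']

theorem half_unique {a b a' b' : L} (ha : a < 1) (hb : 1 < b) (ha' : a' < 1) (hb' : 1 < b')
    {l : List L} (hl : l ∈ Half a b) (hl' : l ∈ Half a' b') : a = a' ∧ b = b' := by
  obtain ⟨-, t, rfl | rfl⟩ := hl <;> obtain ⟨-, t', h | h⟩ := hl' <;>
    simp only [List.cons.injEq] at h <;> obtain ⟨rfl, rfl, -⟩ := h
  · exact ⟨rfl, rfl⟩
  · exact absurd ha hb'.not_gt
  · exact absurd hb ha'.not_gt
  · exact ⟨rfl, rfl⟩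

/-- The parameters of Kuratowski words: a letter, or extremal letters and two halves. -/
abbrev KuratowskiData (L : Type*) [LinearOrder L] [One L] : Type _ :=
  L ⊕ Σ a : Set.Iio (1 : L), Σ b : Set.Ioi (1 : L), Half a.1 b.1 × Half a.1 b.1

/-- The Kuratowski word with given parameters. -/
def wordOfData : KuratowskiData L → kuratowskiWords L
  | .inl x => ⟨FreeSemigroup.of x, mem_kuratowskiWords.2 (.inl ⟨x, rfl⟩)⟩
  | .inr ⟨a, b, l, r⟩ =>
    ⟨ofList (glue l r), ofList_glue_mem ((Set.mem_Iio.1 a.2).trans b.2).ne l.2 r.2⟩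

theorem ofList_glue_eq {a b : L} {l r : List L} (hl : l ∈ Half a b) {w : FreeSemigroup L}
    (h : ofList (glue l r) = w) : glue l r = toList w := by
  rw [← h, toList_ofList]
  have := two_le_length_glue (r := r) hl
  rintro h
  simp [h] at this

theorem wordOfData_bijective : Function.Bijective (wordOfData (L := L)) := by
  constructor
  · have hne (x : L) (a : Set.Iio (1 : L)) (b : Set.Ioi (1 : L)) (l r : Half a.1 b.1) :
        ofList (glue l.1 r.1) ≠ FreeSemigroup.of x := by
      intro h
      have := two_le_length_glue (r := r.1) l.2
      rw [ofList_glue_eq l.2 h] at this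
      simp [toList, FreeSemigroup.of] at this
    rintro (x | ⟨a, b, l, r⟩) (y | ⟨a', b', l', r'⟩) h <;> have h := Subtype.ext_iff.1 h
    · exact congrArg Sum.inl (congrArg FreeSemigroup.head h)
    · exact absurd h.symm (hne _ _ _ _ _)
    · exact absurd h (hne _ _ _ _ _)
    · obtain ⟨a, ha⟩ := a
      obtain ⟨b, hb⟩ := b
      obtain ⟨a', ha'⟩ := a'
      obtain ⟨b', hb'⟩ := b'
      obtain ⟨l, hl⟩ := l
      obtain ⟨r, hr⟩ := r
      obtain ⟨l', hl'⟩ := l'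
      obtain ⟨r', hr'⟩ := r'
      have h := (ofList_glue_eq hl h).trans (ofList_glue_eq hl' rfl).symm
      obtain ⟨rfl, rfl⟩ := half_glue_injective ha hb ha' hb' hl hr hl' hr' h
      obtain ⟨rfl, rfl⟩ := half_unique ha hb ha' hb' hl hl'
      rfl
  · rintro ⟨w, hw⟩
    rcases exists_glue_of_mem hw with ⟨x, rfl⟩ | ⟨a, ha, b, hb, l, hl, r, hr, rfl⟩
    · exact ⟨.inl x, rfl⟩
    · exact ⟨.inr ⟨⟨a, ha⟩, ⟨b, hb⟩, ⟨l, hl⟩, ⟨r, hr⟩⟩, rfl⟩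

theorem card_eq_card_neg_add_card_pos [Finite L] :
    Nat.card L = Nat.card (Set.Iio (1 : L)) + Nat.card (Set.Ioi (1 : L)) + 1 := by
  have h := Set.ncard_add_ncard_compl (Set.Iic (1 : L))
  have h' := Set.ncard_insert_of_notMem (Set.notMem_Iio.2 (le_refl (1 : L)))
  rw [Set.compl_Iic, ← Set.Iio_insert, h'] at h
  rw [Nat.card_coe_set_eq, Nat.card_coe_set_eq, ← h]
  omega

/-- The `n + p + 1` terms with `i = 0` or `j = 0` all equal `1` and account for the one-letter
words. -/
theorem kuratowskiNumber_eq (n p : ℕ) :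
    kuratowskiNumber n p = n + p + 1 + ∑ i ∈ Finset.range n, ∑ j ∈ Finset.range p,
      (i + 1 + (j + 1)).choose (i + 1) * (i + 1 + (j + 1)).choose (i + 1) := by
  have hs (i j : ℕ) : (i + 1 + (j + 1)).choose (j + 1) = (i + 1 + (j + 1)).choose (i + 1) :=
    Nat.choose_symm_of_eq_add (by omega)
  simp only [kuratowskiNumber, Finset.sum_range_succ' _ n, Finset.sum_range_succ' _ p, hs,
    Finset.sum_add_distrib]
  simp
  omega

theorem card_kuratowskiWords [Finite L] :
    Nat.card (kuratowskiWords L) =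
      kuratowskiNumber (Nat.card (Set.Iio (1 : L))) (Nat.card (Set.Ioi (1 : L))) := by
  have := Fintype.ofFinite (Set.Iio (1 : L))
  have := Fintype.ofFinite (Set.Ioi (1 : L))
  have (a : Set.Iio (1 : L)) (b : Set.Ioi (1 : L)) : Finite (Half a.1 b.1) := finite_half a.2 b.2
  have hneg (g : ℕ → ℕ) := sum_depth_eq_sum_range (P := (· ∈ Set.Iio (1 : L)))
    (fun x y hx hy h => by simp only [Set.mem_Iio, Inner] at *; grind)
    (fun z w hz h => by simp only [Set.mem_Iio, Inner] at *; grind) g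
  have hpos (g : ℕ → ℕ) := sum_depth_eq_sum_range (P := (· ∈ Set.Ioi (1 : L)))
    (fun x y hx hy h => by simp only [Set.mem_Ioi, Inner] at *; grind)
    (fun z w hz h => by simp only [Set.mem_Ioi, Inner] at *; grind) g
  rw [← Nat.card_eq_of_bijective _ wordOfData_bijective, Nat.card_sum, Nat.card_sigma,
    card_eq_card_neg_add_card_pos, kuratowskiNumber_eq]
  congr 1
  rw [← hneg fun i => ∑ j ∈ Finset.range (Nat.card (Set.Ioi (1 : L))),
    (i + 1 + (j + 1)).choose (i + 1) * (i + 1 + (j + 1)).choose (i + 1)]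
  refine Finset.sum_congr rfl fun a _ => ?_
  rw [Nat.card_sigma, ← hpos fun j => (depth a.1 + 1 + (j + 1)).choose (depth a.1 + 1) *
    (depth a.1 + 1 + (j + 1)).choose (depth a.1 + 1)]
  refine Finset.sum_congr rfl fun b _ => ?_
  rw [Nat.card_prod, card_half a.2 b.2]

end Counting

end Kuratowski

theorem mainTheorem8 {L : Type*} [LinearOrder L] [One L] :
    Set.BijOn (Kuratowski.FreeKuratowskiMonoid.q L) (Kuratowski.kuratowskiWords L) Set.univ ∧
    (Finite L →
      Nat.card (Kuratowski.FreeKuratowskiMonoid L) = Nat.card (Kuratowski.kuratowskiWords L) ∧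
      Nat.card (Kuratowski.kuratowskiWords L) =
        Kuratowski.kuratowskiNumber
          (Nat.card (Set.Iio (1 : L))) (Nat.card (Set.Ioi (1 : L)))) := by
  refine ⟨Kuratowski.q_bijOn, fun _ => ⟨?_, Kuratowski.card_kuratowskiWords⟩⟩
  rw [Nat.card_congr (Kuratowski.q_bijOn.equiv _), Nat.card_univ]
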